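/- Let $X$ be a reflexive complex Banach space with dual $X^*$, and let $T$ be a bounded linear operator on $X$ with the single valued extension property: for every open $U\subseteq\mathbb C$, the only holomorphic $f:U\to X$ with $(zI-T)f(z)=0$ for all $z\in U$ is $f=0$. Denote by $\sigma(T)$ the spectrum of $T$ and by $T^*$ the Banach space adjoint, $T^*y=y\circ T$, on $X^*$. For a rectifiable Jordan curve $\gamma$ in $\mathbb C$ and $a\notin\gamma$ let $\operatorname{ind}_\gamma(a)=\frac1{2\pi i}\int_\gamma\frac{dz}{z-a}$, and put $\operatorname{int}(\gamma)=\{a\notin\gamma:\operatorname{ind}_\gamma(a)=\pm1\}$ and $\operatorname{ext}(\gamma)=\{a\notin\gamma:\operatorname{ind}_\gamma(a)=0\}$. The curve is positively oriented if its index takes only the values $0$ and $1$ off $\gamma$. Integrability along $\gamma$ means integrability with respect to arc length. Let $\gamma_1,\gamma_2$ be positively oriented rectifiable Jordan curves such that (i) $\gamma_i\cap\sigma(T)$ is non-empty and has zero arc-length measure, for $i=1,2$; (ii) $\operatorname{int}(\gamma_i)\cap\sigma(T)\neq\varnothing$ and $\operatorname{ext}(\gamma_i)\cap\sigma(T)\neq\varnothing$,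 for $i=1,2$; (iii) $\overline{\operatorname{int}(\gamma_1)}\cap\overline{\operatorname{int}(\gamma_2)}=\varnothing$. Assume further that (a) there is $x\in X$ such that $z\mapsto\langle (zI-T)^{-1}x,y\rangle$ is integrable along $\gamma_1$ for every $y\in X^*$, and $\int_{\gamma_1}\langle (zI-T)^{-1}x,y_0\rangle\,dz\neq0$ for some $y_0\in X^*$; (b) there is $x^*\in X^*$ such that $z\mapsto\langle (zI-T^*)^{-1}x^*,h\rangle$ is integrable along $\gamma_2$ for every $h\in X$, and $\int_{\gamma_2}\langle (zI-T^*)^{-1}x^*,h_0\rangle\,dz\neq0$ for some $h_0\in X$. Then $T$ has a non-trivial closed hyperinvariant subspace: there is a closed linear subspace $M$ of $X$, with $M\neq\{0\}$ and $M\neq X$, such that $SM\subseteq M$ for every bounded linear operator $S$ on $X$ that commutes with $T$. -/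

import Mathlib

open MeasureTheory Set
open scoped unitInterval

noncomputable section

/-- A rectifiable Jordan curve in the plane: a continuous closed curve of bounded variation on
`[0, 1]` that is injective on `[0, 1)`. -/
structure RectifiableJordanCurve where
  toFun : I → ℂ
  continuous_toFun : Continuous toFun
  closed : toFun 0 = toFun 1
  injOn : InjOn toFun (Iio 1)
  boundedVariation : BoundedVariationOn toFun univ

namespace RectifiableJordanCurve

variable (γ : RectifiableJordanCurve)

/-- The image of the curve. -/
def trace : Set ℂ := range γ.toFun

/-- The complex Stieltjes measure `dγ` on the parameter interval, with `dγ (a, b] = γ b - γ a`. -/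
def dz : VectorMeasure I ℂ := γ.boundedVariation.vectorMeasure

/-- The arc-length measure `|dz|` of the curve, as a measure on the plane. -/
def arcLength : Measure ℂ := γ.dz.variation.map γ.toFun

/-- Integrability of `f` along the curve, with respect to arc length. -/
def Integrable (f : ℂ → ℂ) : Prop := γ.dz.Integrable fun t => f (γ.toFun t)

/-- The line integral of `f` along the curve, `∫ f(γ(t)) dγ(t)`, the product being that of `ℂ`. -/
def lineIntegral (f : ℂ → ℂ) : ℂ :=
  γ.dz.integral (fun t => f (γ.toFun t)) (ContinuousLinearMap.mul ℝ ℂ)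

/-- The index of the curve with respect to a point `a` (off the curve). -/
def index (a : ℂ) : ℂ :=
  (2 * Real.pi * Complex.I)⁻¹ * γ.lineIntegral fun z => (z - a)⁻¹

/-- The interior: the points off the curve with index `1` or `-1`. -/
def interior : Set ℂ := {a | a ∉ γ.trace ∧ (γ.index a = 1 ∨ γ.index a = -1)}

/-- The exterior: the points off the curve with index `0`. -/
def exterior : Set ℂ := {a | a ∉ γ.trace ∧ γ.index a = 0}

/-- Positive orientation: off the curve, the index takes only the values `0` and `1`. -/
def IsPositivelyOriented : Prop := ∀ a ∉ γ.trace, γ.index a = 0 ∨ γ.index a = 1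

end RectifiableJordanCurve

section Operators

variable {X : Type*} [NormedAddCommGroup X] [NormedSpace ℂ X]

/-- The single valued extension property: on every open `U ⊆ ℂ`, the only holomorphic
`f : U → X` with `(z - T) f(z) = 0` on `U` is zero. -/
def HasSVEP (T : X →L[ℂ] X) : Prop :=
  ∀ U : Set ℂ, IsOpen U → ∀ f : ℂ → X, DifferentiableOn ℂ f U →
    (∀ z ∈ U, z • f z - T (f z) = 0) → ∀ z ∈ U, f z = 0

/-- The Banach space adjoint `T* y = y ∘ T` on the dual space. -/
def dualOperator (T : X →L[ℂ] X) : StrongDual ℂ X →L[ℂ] StrongDual ℂ X :=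
  (ContinuousLinearMap.compL ℂ X X ℂ).flip T

/-- A subspace invariant under every bounded operator that commutes with `T`. -/
def IsHyperinvariant (T : X →L[ℂ] X) (M : Submodule ℂ X) : Prop :=
  ∀ S : X →L[ℂ] X, Commute S T → ∀ x ∈ M, S x ∈ M

variable (X) in
/-- Reflexivity: the canonical embedding into the bidual is onto. -/
def IsReflexiveSpace : Prop :=
  Function.Surjective (NormedSpace.inclusionInDoubleDual ℂ X)

end Operators

end

/-!
# A hyperinvariant subspace from two disjoint contour integrals of the resolvent

Integrating the local resolvent over `γ₁` produces a nonzero vector `x₁`, and over `γ₂` a nonzero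
functional `G₂`. It is enough to show `G₂ (S x₁) = 0` for every `S` commuting with `T`: then the
vectors whose whole orbit under the commutant is annihilated by `G₂` form the required subspace
(`exists_hyperinvariant_of_annihilated_orbit`).

The weak integrals exist by the closed graph theorem, and reflexivity places the first one in `X`.
With the kernel `1 / (z - a)` inserted, the same integral defines `g₁ a` and `g₂ a` for `a` in the
exterior of the respective curve. They solve `(T - a) g₁ a = x₁` and `(T* - a) g₂ a = G₂` there,
because the index vanishes (`RectifiableJordanCurve.exists_truncated_projection`). On the common
part of the two exteriors the functions `a ↦ ⟨S (g₁ a), G₂⟩` and `a ↦ ⟨S x₁, g₂ a⟩` agree. If the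
exteriors cover the plane, these functions glue to an entire function which vanishes at infinity,
hence is zero, and its leading coefficient at infinity is `-G₂ (S x₁)`
(`eq_zero_of_tendsto_mul_of_eqOn`).

That the exteriors cover the plane requires part of the Jordan curve theorem: every point of a
positively oriented curve is a limit of points of index `1`
(`RectifiableJordanCurve.IsPositivelyOriented.trace_subset_closure_interior`). Otherwise the Cauchy
transform of the measure `dz` vanishes off the curve on some neighbourhood of a point of the curve,
so almost everywhere there, as a rectifiable curve has area zero. By the Cauchy–Pompeiu formula
(`integral_twiceDbar_div`) `dz` then has no mass on compact sets in that neighbourhood. On a short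
arc from `p` to `q` this mass is `q - p`, which contradicts injectivity.
-/

open Filter Topology Bornology

/-! ### Complex measures and their total variation -/

namespace MeasureTheory.VectorMeasure

variable {α : Type*} [MeasurableSpace α]

instance isFiniteMeasure_variation_complex (c : VectorMeasure α ℂ) :
    IsFiniteMeasure c.variation := by
  have h : c.variation ≤
      (ComplexMeasure.re c).totalVariation + (ComplexMeasure.im c).totalVariation := by
    refine VectorMeasure.variation_le_of_forall_enorm_le fun s hs => ?_
    rw [Measure.add_apply]
    calc ‖c s‖ₑ ≤ ‖(c s).re‖ₑ + ‖(c s).im‖ₑ := by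
          rw [← ofReal_norm, ← ofReal_norm, ← ofReal_norm, ← ENNReal.ofReal_add (by simp) (by simp)]
          exact ENNReal.ofReal_le_ofReal (Complex.norm_le_abs_re_add_abs_im _)
      _ ≤ _ := add_le_add ((ComplexMeasure.re c).enorm_le_totalVariation s)
          ((ComplexMeasure.im c).enorm_le_totalVariation s)
  exact isFiniteMeasure_of_le _ h

/-- The density of a complex measure with respect to its total variation, built from the
Radon–Nikodym derivatives of the real and imaginary parts. -/
noncomputable def density (c : VectorMeasure α ℂ) (x : α) : ℂ :=
  ⟨(ComplexMeasure.re c).rnDeriv c.variation x,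
    (ComplexMeasure.im c).rnDeriv c.variation x⟩

variable (c : VectorMeasure α ℂ)

theorem measurable_density : Measurable c.density :=
  Complex.measurableEquivRealProd.symm.measurable.comp
    ((SignedMeasure.measurable_rnDeriv _ _).prodMk (SignedMeasure.measurable_rnDeriv _ _))

theorem integrable_density :
    Integrable c.density c.variation := by
  refine ⟨c.measurable_density.aestronglyMeasurable, ?_⟩
  have h1 := SignedMeasure.integrable_rnDeriv (ComplexMeasure.re c) c.variation
  have h2 := SignedMeasure.integrable_rnDeriv (ComplexMeasure.im c) c.variation
  refine ((h1.abs.add h2.abs).mono' c.measurable_density.aestronglyMeasurable ?_).2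
  exact Filter.Eventually.of_forall fun x => Complex.norm_le_abs_re_add_abs_im _

theorem absolutelyContinuous_variation :
    c ≪ᵥ c.variation.toENNRealVectorMeasure := by
  refine VectorMeasure.AbsolutelyContinuous.mk fun s hs h => ?_
  rw [Measure.toENNRealVectorMeasure_apply_measurable hs] at h
  have := c.enorm_measure_le_variation s
  rw [h] at this
  simpa using this

theorem setIntegral_density {s : Set α} (hs : MeasurableSet s) :
    ∫ x in s, c.density x ∂c.variation = c s := by
  obtain ⟨hre, him⟩ := (ComplexMeasure.absolutelyContinuous_ennreal_iff c _).1
    c.absolutelyContinuous_variation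
  have hi := c.integrable_density.integrableOn (s := s)
  have e1 := congrArg (fun m => m s) (SignedMeasure.withDensityᵥ_rnDeriv_eq _ _ hre)
  have e2 := congrArg (fun m => m s) (SignedMeasure.withDensityᵥ_rnDeriv_eq _ _ him)
  simp only [withDensityᵥ_apply (SignedMeasure.integrable_rnDeriv _ _) hs] at e1 e2
  apply Complex.ext
  · rw [← Complex.reCLM_apply, ← ContinuousLinearMap.integral_comp_comm _ hi]
    exact e1
  · rw [← Complex.imCLM_apply, ← ContinuousLinearMap.integral_comp_comm _ hi]
    exact e2

/-- The sharp bound is `1`; bounding the real and imaginary parts separately gives `2`, which is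
enough for integrability. -/
theorem norm_density_le :
    ∀ᵐ x ∂c.variation, ‖c.density x‖ ≤ 2 := by
  have key : ∀ L : ℂ →L[ℝ] ℝ, (∀ z, |L z| ≤ ‖z‖) →
      ∀ᵐ x ∂c.variation, L (c.density x) ≤ 1 := by
    intro L hL
    refine ae_le_of_forall_setIntegral_le (L.integrable_comp c.integrable_density)
      (integrable_const _) fun s hs hs' => ?_
    rw [ContinuousLinearMap.integral_comp_comm _ c.integrable_density.integrableOn,
      c.setIntegral_density hs, MeasureTheory.setIntegral_const, smul_eq_mul, mul_one]
    refine (le_abs_self _).trans ((hL _).trans ?_)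
    exact VectorMeasure.norm_measure_le_variation (μ := c) hs'.ne
  filter_upwards [key Complex.reCLM Complex.abs_re_le_norm, key Complex.imCLM Complex.abs_im_le_norm,
    key (-Complex.reCLM) (by simpa using Complex.abs_re_le_norm),
    key (-Complex.imCLM) (by simpa using Complex.abs_im_le_norm)] with x h1 h2 h3 h4
  simp at h1 h2 h3 h4
  have := Complex.norm_le_abs_re_add_abs_im (c.density x)
  have a1 : |(c.density x).re| ≤ 1 := abs_le.2 ⟨by linarith, h1⟩
  have a2 : |(c.density x).im| ≤ 1 := abs_le.2 ⟨by linarith, h2⟩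
  linarith

theorem integrable_mul_density {f : α → ℂ}
    (hf : Integrable f c.variation) :
    Integrable (fun x => f x * c.density x) c.variation :=
  MeasureTheory.Integrable.mul_bdd hf c.measurable_density.aestronglyMeasurable c.norm_density_le

theorem integral_eq_integral_mul_density {f : α → ℂ}
    (hf : Integrable f c.variation) :
    VectorMeasure.integral c f (ContinuousLinearMap.mul ℝ ℂ) =
      ∫ x, f x * c.density x ∂c.variation := by
  -- Both sides are continuous on `L¹` and agree on indicators.
  refine Integrable.induction (μ := c.variation) (fun f => VectorMeasure.integral c f
    (ContinuousLinearMap.mul ℝ ℂ) = ∫ x, f x * c.density x ∂c.variation) ?_ ?_ ?_ ?_ hf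
  · intro a s hs hfin
    rw [VectorMeasure.integral_eq_setToFun, setToFun_indicator_const _ hs hfin.ne]
    have : (fun x => indicator s (fun _ => a) x * c.density x) =
        indicator s fun x => a * c.density x := by
      ext x; exact (indicator_mul_left s (fun _ => a) c.density).symm
    rw [this, MeasureTheory.integral_indicator hs, MeasureTheory.integral_const_mul,
      c.setIntegral_density hs]
    rfl
  · intro f g _ hf hg h1 h2
    rw [VectorMeasure.integral_add hf hg, h1, h2,
      ← MeasureTheory.integral_add (c.integrable_mul_density hf) (c.integrable_mul_density hg)]
    simp [add_mul]
  · refine isClosed_eq (continuous_setToFun _) ?_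
    refine (LipschitzWith.of_dist_le_mul (K := 2) fun f g => ?_).continuous
    rw [dist_eq_norm, dist_eq_norm,
      ← MeasureTheory.integral_sub (c.integrable_mul_density (L1.integrable_coeFn f))
      (c.integrable_mul_density (L1.integrable_coeFn g)), L1.norm_eq_integral_norm,
      NNReal.coe_ofNat, ← MeasureTheory.integral_const_mul]
    refine norm_integral_le_of_norm_le ((L1.integrable_coeFn (f - g)).norm.const_mul 2) ?_
    filter_upwards [Lp.coeFn_sub f g, c.norm_density_le] with x hx hd
    rw [← sub_mul, norm_mul, hx, Pi.sub_apply, mul_comm]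
    gcongr
  · intro f g h hf h1
    rw [← VectorMeasure.integral_congr_ae h, h1]
    exact MeasureTheory.integral_congr_ae (h.mono fun x hx => by simp [hx])

end MeasureTheory.VectorMeasure

/-! ### Cauchy transforms and the index of a curve -/

section CauchyTransform

variable {α : Type*} [MeasurableSpace α] {μ : Measure α} {p φ : α → ℂ} {a : ℂ}

/-- The Cauchy transform `a ↦ ∫ φ / (p - a) ∂μ` of the image under `p` of the measure `φ μ`. For
integrable `φ`, the integrand can only fail to be integrable on the closure of the range of `p`;
the value at such points is the junk value `0`. -/
noncomputable def cauchyTransform (μ : Measure α) (p φ : α → ℂ) (a : ℂ) : ℂ :=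
  ∫ t, (p t - a)⁻¹ * φ t ∂μ

theorem integrable_cauchyKernel_mul (hp : Measurable p) (hφ : Integrable φ μ)
    (ha : a ∉ closure (range p)) : Integrable (fun t => (p t - a)⁻¹ * φ t) μ := by
  obtain ⟨δ, hδ, hd⟩ := Metric.mem_nhds_iff.1 (isClosed_closure.isOpen_compl.mem_nhds ha)
  refine hφ.bdd_mul (c := δ⁻¹) (hp.sub_const a).inv.aestronglyMeasurable (.of_forall fun t => ?_)
  have : δ ≤ ‖p t - a‖ := by
    by_contra! h
    exact hd (by simpa [dist_eq_norm] using h) (subset_closure (mem_range_self t))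
  rw [norm_inv]
  gcongr

theorem differentiableAt_cauchyTransform (hp : Measurable p) (hφ : Integrable φ μ)
    (ha : a ∉ closure (range p)) : DifferentiableAt ℂ (cauchyTransform μ p φ) a := by
  obtain ⟨δ, hδ, hd⟩ := Metric.mem_nhds_iff.1 (isClosed_closure.isOpen_compl.mem_nhds ha)
  have hfar : ∀ b ∈ Metric.ball a (δ / 2), ∀ t, δ / 2 ≤ ‖p t - b‖ := by
    intro b hb t
    by_contra! h
    refine hd ?_ (subset_closure (mem_range_self t))
    have := dist_triangle (p t) b a
    rw [Metric.mem_ball] at hb ⊢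
    rw [dist_eq_norm (p t) b] at this
    linarith
  have hne : ∀ b ∈ Metric.ball a (δ / 2), ∀ t, p t - b ≠ 0 := fun b hb t h => by
    have := hfar b hb t
    rw [h, norm_zero] at this
    linarith
  refine (hasDerivAt_integral_of_dominated_loc_of_deriv_le (μ := μ)
    (F := fun b t => (p t - b)⁻¹ * φ t) (F' := fun b t => (p t - b)⁻¹ ^ 2 * φ t)
    (bound := fun t => (δ / 2)⁻¹ ^ 2 * ‖φ t‖) (s := Metric.ball a (δ / 2))
    (Metric.ball_mem_nhds a (half_pos hδ)) ?_ ?_ ?_ ?_ ?_ ?_).2.differentiableAt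
  · exact .of_forall fun b => (hp.sub_const b).inv.aestronglyMeasurable.mul hφ.1
  · exact integrable_cauchyKernel_mul hp hφ ha
  · exact ((hp.sub_const a).inv.pow_const 2).aestronglyMeasurable.mul hφ.1
  · refine .of_forall fun t b hb => ?_
    rw [norm_mul, norm_pow, norm_inv]
    have := hfar b hb t
    gcongr
  · exact hφ.norm.const_mul _
  · refine .of_forall fun t b hb => ?_
    have := (((hasDerivAt_id b).const_sub (p t)).inv (hne b hb t)).mul_const (φ t)
    simpa [div_eq_mul_inv, Pi.inv_def] using this

theorem tendsto_mul_cauchyTransform (hp : Measurable p) (hb : IsBounded (range p))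
    (hφ : Integrable φ μ) :
    Tendsto (fun a => a * cauchyTransform μ p φ a) (cobounded ℂ) (𝓝 (-∫ t, φ t ∂μ)) := by
  obtain ⟨R, hR⟩ := hb.exists_norm_le
  have hR' : ∀ t, ‖p t‖ ≤ R := fun t => hR _ (mem_range_self t)
  have hcg : (cobounded ℂ).IsCountablyGenerated := by
    rw [← comap_norm_atTop]; infer_instance
  simp only [cauchyTransform, ← integral_const_mul, ← integral_neg]
  refine tendsto_integral_filter_of_dominated_convergence (fun t => 2 * ‖φ t‖)
    (.of_forall fun a => (((hp.sub_const a).inv.aestronglyMeasurable.mul hφ.1).const_mul a)) ?_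
    (hφ.norm.const_mul 2) (.of_forall fun t => ?_)
  · filter_upwards [(tendsto_norm_cobounded_atTop (E := ℂ)).eventually_ge_atTop (2 * R),
      (tendsto_norm_cobounded_atTop (E := ℂ)).eventually_gt_atTop 0] with a ha ha0
    refine .of_forall fun t => ?_
    have h1 : ‖a‖ ≤ 2 * ‖p t - a‖ := by
      have := norm_sub_norm_le a (p t)
      rw [norm_sub_rev] at this
      linarith [hR' t]
    rw [← mul_assoc, norm_mul, norm_mul, norm_inv]
    gcongr
    rwa [← div_eq_mul_inv, div_le_iff₀ (by linarith)]
  · have h1 : Tendsto (fun a : ℂ => p t * a⁻¹ - 1) (cobounded ℂ) (𝓝 (-1)) := by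
      simpa using (tendsto_inv₀_cobounded (α := ℂ)).const_mul (p t) |>.sub_const 1
    have h2 := (h1.inv₀ (by simp)).mul_const (φ t)
    have h3 : ((-1 : ℂ))⁻¹ * φ t = -φ t := by norm_num
    rw [h3] at h2
    refine h2.congr' ?_
    filter_upwards [(tendsto_norm_cobounded_atTop (E := ℂ)).eventually_gt_atTop 0] with a ha
    have ha' : a ≠ 0 := norm_pos_iff.1 ha
    have : p t * a⁻¹ - 1 = (p t - a) * a⁻¹ := by field_simp
    rw [this, mul_inv, inv_inv]
    ring

end CauchyTransform

namespace RectifiableJordanCurve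

variable (γ : RectifiableJordanCurve)

/-- The density of `dz` with respect to arc length on the parameter interval, that is, the unit
tangent vector. -/
noncomputable def tangent (t : I) : ℂ := VectorMeasure.density γ.dz t

theorem integrable_tangent : MeasureTheory.Integrable γ.tangent γ.dz.variation :=
  γ.dz.integrable_density

theorem isCompact_trace : IsCompact γ.trace := isCompact_range γ.continuous_toFun

theorem closure_range_toFun : closure (range γ.toFun) = γ.trace :=
  γ.isCompact_trace.isClosed.closure_eq

theorem lineIntegral_eq {f : ℂ → ℂ} (hf : γ.Integrable f) :
    γ.lineIntegral f = ∫ t, f (γ.toFun t) * γ.tangent t ∂γ.dz.variation :=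
  γ.dz.integral_eq_integral_mul_density hf

theorem index_eq_cauchyTransform {a : ℂ} (ha : a ∉ γ.trace) :
    γ.index a = (2 * Real.pi * Complex.I)⁻¹ *
      cauchyTransform γ.dz.variation γ.toFun γ.tangent a := by
  have h := integrable_cauchyKernel_mul (μ := γ.dz.variation) (φ := fun _ => 1)
    γ.continuous_toFun.measurable (integrable_const _) (by rwa [closure_range_toFun])
  rw [index, lineIntegral_eq, cauchyTransform]
  have h' : MeasureTheory.Integrable (fun t => (γ.toFun t - a)⁻¹) γ.dz.variation := by
    simpa only [mul_one] using h
  exact h'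

theorem differentiableAt_cauchyTransform {φ : I → ℂ}
    (hφ : MeasureTheory.Integrable φ γ.dz.variation) {a : ℂ} (ha : a ∉ γ.trace) :
    DifferentiableAt ℂ (cauchyTransform γ.dz.variation γ.toFun φ) a :=
  _root_.differentiableAt_cauchyTransform γ.continuous_toFun.measurable hφ
    (by rwa [closure_range_toFun])

theorem cauchyTransform_tangent_eq_zero {a : ℂ} (ha : a ∈ γ.exterior) :
    cauchyTransform γ.dz.variation γ.toFun γ.tangent a = 0 := by
  have h := ha.2
  rw [γ.index_eq_cauchyTransform ha.1] at h
  simpa [Real.pi_ne_zero] using h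

theorem tendsto_index_cobounded : Tendsto γ.index (cobounded ℂ) (𝓝 0) := by
  have h := (tendsto_mul_cauchyTransform γ.continuous_toFun.measurable
    γ.isCompact_trace.isBounded γ.integrable_tangent).mul tendsto_inv₀_cobounded
  rw [mul_zero] at h
  have h2 := h.const_mul (2 * Real.pi * Complex.I : ℂ)⁻¹
  rw [mul_zero] at h2
  refine h2.congr' ?_
  filter_upwards [(tendsto_norm_cobounded_atTop (E := ℂ)).eventually_gt_atTop 0,
    isBounded_def.1 γ.isCompact_trace.isBounded] with a ha ha2
  rw [γ.index_eq_cauchyTransform ha2]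
  have : a ≠ 0 := norm_pos_iff.1 ha
  field_simp

variable {γ}

theorem IsPositivelyOriented.mem_exterior_of_norm_index_lt_one (hγ : γ.IsPositivelyOriented)
    {a : ℂ} (ha : a ∉ γ.trace) (h : ‖γ.index a‖ < 1) : a ∈ γ.exterior := by
  refine ⟨ha, (hγ a ha).resolve_right fun h1 => ?_⟩
  simp [h1] at h

theorem IsPositivelyOriented.isOpen_exterior (hγ : γ.IsPositivelyOriented) :
    IsOpen γ.exterior := by
  rw [isOpen_iff_mem_nhds]
  intro a ha
  have hU : ∀ᶠ b in 𝓝 a, b ∉ γ.trace := γ.isCompact_trace.isClosed.isOpen_compl.mem_nhds ha.1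
  have hc : Tendsto γ.index (𝓝 a) (𝓝 0) := by
    have := ((γ.differentiableAt_cauchyTransform γ.integrable_tangent ha.1).continuousAt.tendsto
      ).const_mul (2 * Real.pi * Complex.I : ℂ)⁻¹
    rw [γ.cauchyTransform_tangent_eq_zero ha, mul_zero] at this
    exact this.congr' (hU.mono fun b hb => (γ.index_eq_cauchyTransform hb).symm)
  filter_upwards [hU, hc.norm.eventually_lt_const (by simp : ‖(0 : ℂ)‖ < 1)] with b hb1 hb2
  exact hγ.mem_exterior_of_norm_index_lt_one hb1 hb2

theorem IsPositivelyOriented.eventually_mem_exterior (hγ : γ.IsPositivelyOriented) :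
    ∀ᶠ a in cobounded ℂ, a ∈ γ.exterior := by
  filter_upwards [isBounded_def.1 γ.isCompact_trace.isBounded,
    γ.tendsto_index_cobounded.norm.eventually_lt_const (by simp : ‖(0 : ℂ)‖ < 1)] with b hb1 hb2
  exact hγ.mem_exterior_of_norm_index_lt_one hb1 hb2

end RectifiableJordanCurve

/-! ### Rectifiable curves have area zero -/

section BoundedVariation

open scoped NNReal ENNReal

theorem LocallyBoundedVariationOn.dimH_image_le_one {α E : Type*} [LinearOrder α]
    [MetricSpace E] {f : α → E} {s : Set α}
    (hf : LocallyBoundedVariationOn f s) : dimH (f '' s) ≤ 1 := by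
  obtain rfl | ⟨a, ha⟩ := s.eq_empty_or_nonempty
  · simp
  have hspeed := has_unit_speed_naturalParameterization f hf ha
  have hlip : LipschitzOnWith 1 (naturalParameterization f s a) (variationOnFromTo f s a '' s) := by
    intro x hx y hy
    wlog hxy : x ≤ y generalizing x y
    · rw [edist_comm, edist_comm x]
      exact this hy hx (le_of_not_ge hxy)
    refine (eVariationOn.edist_le (s := variationOnFromTo f s a '' s ∩ Icc x y) _
      ⟨hx, le_rfl, hxy⟩ ⟨hy, hxy, le_rfl⟩).trans ?_
    rw [hspeed hx hy, edist_comm, edist_dist, Real.dist_eq, abs_of_nonneg (by linarith)]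
    simp
  have himg : f '' s = naturalParameterization f s a '' (variationOnFromTo f s a '' s) := by
    rw [image_image]
    exact image_congr fun b hb =>
      (edist_eq_zero.1 (edist_naturalParameterization_eq_zero hf ha hb)).symm
  rw [himg]
  exact hlip.dimH_image_le.trans ((dimH_mono (subset_univ _)).trans Real.dimH_univ.le)

theorem Complex.volume_eq_zero_of_dimH_lt_two {s : Set ℂ} (hs : dimH s < 2) : volume s = 0 := by
  have h1 : dimH (Complex.equivRealProdCLM '' s) < 2 := by
    rwa [ContinuousLinearEquiv.dimH_image]
  have h2 := hausdorffMeasure_of_dimH_lt (d := 2) (by exact_mod_cast h1)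
  rw [NNReal.coe_ofNat, hausdorffMeasure_prod_real] at h2
  have h3 := Complex.volume_preserving_equiv_real_prod.measure_preimage_equiv
    (Complex.equivRealProdCLM '' s)
  rw [h2] at h3
  refine measure_mono_null ?_ h3
  exact fun z hz => ⟨z, hz, rfl⟩

end BoundedVariation

theorem RectifiableJordanCurve.volume_trace (γ : RectifiableJordanCurve) : volume γ.trace = 0 := by
  refine Complex.volume_eq_zero_of_dimH_lt_two ?_
  rw [trace, ← image_univ]
  exact (LocallyBoundedVariationOn.dimH_image_le_one
    γ.boundedVariation.locallyBoundedVariationOn).trans_lt (by norm_num)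

theorem RectifiableJordanCurve.dz_Icc (γ : RectifiableJordanCurve) {s t : I} (h : s ≤ t) :
    γ.dz (Icc s t) = γ.toFun t - γ.toFun s := by
  rw [dz, BoundedVariationOn.vectorMeasure_Icc _ h,
    (γ.continuous_toFun.continuousWithinAt).rightLim_eq,
    (γ.continuous_toFun.continuousWithinAt).leftLim_eq]

/-! ### The Cauchy–Pompeiu formula -/

section CauchyPompeiu

/-- Twice the Wirtinger derivative `∂/∂z̄`, that is, `∂/∂x + i ∂/∂y`. -/
noncomputable def twiceDbar (f : ℂ → ℂ) (a : ℂ) : ℂ :=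
  fderiv ℝ f a 1 + Complex.I * fderiv ℝ f a Complex.I

variable {f : ℂ → ℂ}

theorem continuous_twiceDbar (hf : ContDiff ℝ 1 f) : Continuous (twiceDbar f) := by
  have h := hf.continuous_fderiv one_ne_zero
  unfold twiceDbar
  fun_prop

theorem support_twiceDbar_subset : Function.support (twiceDbar f) ⊆ tsupport f := by
  intro a ha
  refine support_fderiv_subset ℝ (f := f) fun h => ha ?_
  simp [twiceDbar, h]

theorem HasCompactSupport.twiceDbar (hc : HasCompactSupport f) : HasCompactSupport (twiceDbar f) :=
  hc.mono' support_twiceDbar_subset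

/-- The Cauchy–Pompeiu formula for compactly supported functions: in polar coordinates around `w`
the integrand is `∂f/∂r + (i / r) ∂f/∂θ`; the first term integrates to `-2π f w` and the second one
to `0` over each circle. -/
theorem integral_twiceDbar_div (hf : ContDiff ℝ 1 f) (hc : HasCompactSupport f) (w : ℂ) :
    ∫ b, twiceDbar f (w + b) / b = -(2 * Real.pi) * f w := by
  let e : ℝ → ℂ := fun θ => Real.cos θ + Real.sin θ * Complex.I
  have hedef : ∀ θ : ℝ, e θ = Complex.exp (θ * Complex.I) := fun θ => by
    rw [Complex.exp_mul_I]; simp [e]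
  have hecont : Continuous e := by simp only [e]; fun_prop
  have henorm : ∀ θ, ‖e θ‖ = 1 := fun θ => by rw [hedef, Complex.norm_exp_ofReal_mul_I]
  have hene : ∀ θ, e θ ≠ 0 := fun θ h => by simpa [h] using henorm θ
  have hderiv : ∀ θ, HasDerivAt e (Complex.I * e θ) θ := fun θ => by
    have h := ((Complex.ofRealCLM.hasDerivAt (x := θ)).mul_const Complex.I).cexp
    simp only [Complex.ofRealCLM_apply, Complex.ofReal_one, one_mul] at h
    rw [hedef, mul_comm]
    exact h.congr_of_eventuallyEq (.of_forall hedef)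
  -- `P` is the radial derivative `∂f/∂r` and `Q` is `(i / r) ∂f/∂θ`, with the factor `r` cancelled.
  let P : ℝ × ℝ → ℂ := fun q => fderiv ℝ f (w + q.1 * e q.2) (e q.2)
  let Q : ℝ × ℝ → ℂ := fun q => Complex.I * fderiv ℝ f (w + q.1 * e q.2) (Complex.I * e q.2)
  have hfd := hf.continuous_fderiv one_ne_zero
  have hPc : Continuous P := by simp only [P]; fun_prop
  have hQc : Continuous Q := by simp only [Q]; fun_prop
  have hdiff : Differentiable ℝ f := hf.differentiable one_ne_zero
  obtain ⟨R, hR0, hR⟩ : ∃ R > 0, ∀ a, f a ≠ 0 ∨ fderiv ℝ f a ≠ 0 → ‖a - w‖ ≤ R := by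
    obtain ⟨R, hR⟩ := (hc.isCompact.isBounded).subset_closedBall w
    refine ⟨max R 1, by positivity, fun a ha => ?_⟩
    have : a ∈ tsupport f := ha.elim (fun h => subset_tsupport f h)
      (fun h => support_fderiv_subset ℝ h)
    exact (mem_closedBall_iff_norm.1 (hR this)).trans (le_max_left _ _)
  have hfar : ∀ r θ : ℝ, R < r → f (w + r * e θ) = 0 ∧ fderiv ℝ f (w + r * e θ) = 0 := by
    intro r θ hr
    by_contra! h
    have h2 := hR (w + r * e θ) (by
      by_cases h0 : f (w + r * e θ) = 0
      exacts [.inr (h h0), .inl h0])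
    simp [henorm, abs_of_pos (hR0.trans hr)] at h2
    linarith
  set S : Set (ℝ × ℝ) := Ioi 0 ×ˢ Ioo (-Real.pi) Real.pi
  have hint : ∀ G : ℝ × ℝ → ℂ, Continuous G → (∀ q, R < q.1 → G q = 0) → IntegrableOn G S := by
    intro G hG h0
    have h1 : IntegrableOn G (Icc 0 R ×ˢ Icc (-Real.pi) Real.pi) :=
      hG.continuousOn.integrableOn_compact (isCompact_Icc.prod isCompact_Icc)
    refine h1.of_forall_sdiff_eq_zero (measurableSet_Ioi.prod measurableSet_Ioo) ?_
    rintro ⟨r, θ⟩ ⟨⟨hr, hθ⟩, hn⟩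
    refine h0 _ ?_
    by_contra! h
    exact hn ⟨⟨le_of_lt hr, h⟩, Ioo_subset_Icc_self hθ⟩
  have hPi : IntegrableOn P S := hint P hPc fun q hq => by simp [P, (hfar q.1 q.2 hq).2]
  have hQi : IntegrableOn Q S := hint Q hQc fun q hq => by simp [Q, (hfar q.1 q.2 hq).2]
  have hpolar : ∫ b, twiceDbar f (w + b) / b = ∫ q in S, (P q + Q q) := by
    rw [← Complex.integral_comp_polarCoord_symm, polarCoord_target]
    refine setIntegral_congr_fun (measurableSet_Ioi.prod measurableSet_Ioo) ?_
    rintro ⟨r, θ⟩ ⟨hr, -⟩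
    have hr' : (r : ℂ) ≠ 0 := by exact_mod_cast (ne_of_gt hr)
    have he : Complex.polarCoord.symm (r, θ) = r * e θ := by
      rw [Complex.polarCoord_symm_apply]
    have hlin : ∀ (L : ℂ →L[ℝ] ℂ) (x y : ℝ),
        L (x + y * Complex.I) = x * L 1 + y * L Complex.I := by
      intro L x y
      have : (x + y * Complex.I : ℂ) = x • (1 : ℂ) + y • Complex.I := by simp
      rw [this, map_add, map_smul, map_smul]; simp
    have hIe : Complex.I * e θ = ((-Real.sin θ : ℝ) : ℂ) + (Real.cos θ : ℝ) * Complex.I := by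
      simp only [e]; push_cast; linear_combination (Complex.sin θ) * Complex.I_sq
    simp only [he, P, Q]
    rw [hIe, hlin, show e θ = (Real.cos θ : ℝ) + (Real.sin θ : ℝ) * Complex.I from rfl, hlin,
      ← show e θ = (Real.cos θ : ℝ) + (Real.sin θ : ℝ) * Complex.I from rfl, twiceDbar,
      Complex.real_smul]
    field_simp [hene θ]
    have hcs : (Complex.cos θ) ^ 2 + (Complex.sin θ) ^ 2 = 1 := Complex.cos_sq_add_sin_sq _
    simp only [e]
    push_cast
    generalize fderiv ℝ f _ 1 = A
    generalize fderiv ℝ f _ Complex.I = B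
    linear_combination (-(A + Complex.I * B)) * hcs +
      (A * Complex.sin θ ^ 2 - B * Complex.cos θ * Complex.sin θ) * Complex.I_sq
  have hPint : ∫ q in S, P q = -(2 * Real.pi) * f w := by
    rw [Measure.volume_eq_prod, ← Measure.prod_restrict, integral_prod_symm]
    · have h1 : ∀ θ : ℝ, ∫ r in Ioi (0 : ℝ), P (r, θ) = -f w := by
        intro θ
        have hd : ∀ r : ℝ, HasDerivAt (fun r : ℝ => f (w + r * e θ)) (P (r, θ)) r := by
          intro r
          have h2 : HasDerivAt (fun r : ℝ => w + r * e θ) (e θ) r := by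
            simpa using ((Complex.ofRealCLM.hasDerivAt (x := r)).mul_const (e θ)).const_add w
          exact (hdiff _).hasFDerivAt.comp_hasDerivAt r h2
        have h3 := integral_Ioi_of_hasDerivAt_of_tendsto (a := 0) (m := 0)
          (hd 0).continuousAt.continuousWithinAt (fun r _ => hd r) ?_ ?_
        · simpa using h3
        · have h4 : IntegrableOn (fun r => P (r, θ)) (Icc 0 R) :=
            (by fun_prop : Continuous fun r => P (r, θ)).continuousOn.integrableOn_compact
              isCompact_Icc
          refine h4.of_forall_sdiff_eq_zero measurableSet_Ioi ?_
          rintro r ⟨hr, hn⟩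
          have : R < r := by
            by_contra! h
            exact hn ⟨le_of_lt hr, h⟩
          simp [P, (hfar r θ this).2]
        · refine tendsto_const_nhds.congr' ?_
          filter_upwards [eventually_gt_atTop R] with r hr
          exact (hfar r θ hr).1.symm
      simp only [h1]
      rw [setIntegral_const, Real.volume_real_Ioo_of_le (by linarith [Real.pi_pos]),
        Complex.real_smul]
      push_cast
      ring
    · rw [Measure.prod_restrict]
      exact hPi
  have hQint : ∫ q in S, Q q = 0 := by
    rw [Measure.volume_eq_prod, setIntegral_prod _ hQi]
    refine (setIntegral_congr_fun measurableSet_Ioi fun r hr => ?_).trans (integral_zero _ _)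
    have hd : ∀ θ : ℝ, HasDerivAt (fun θ : ℝ => Complex.I * (r : ℂ)⁻¹ * f (w + r * e θ))
        (Q (r, θ)) θ := by
      intro θ
      have h2 : HasDerivAt (fun θ : ℝ => w + r * e θ) (r * (Complex.I * e θ)) θ :=
        ((hderiv θ).const_mul _).const_add w
      have h3 := ((hdiff _).hasFDerivAt.comp_hasDerivAt θ h2).const_mul (Complex.I * (r : ℂ)⁻¹)
      refine h3.congr_deriv ?_
      have hr' : (r : ℂ) ≠ 0 := by exact_mod_cast (ne_of_gt hr)
      have h4 : fderiv ℝ f (w + r * e θ) (r * (Complex.I * e θ)) =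
          r * fderiv ℝ f (w + r * e θ) (Complex.I * e θ) := by
        simpa only [Complex.real_smul] using
          (fderiv ℝ f (w + r * e θ)).map_smul r (Complex.I * e θ)
      rw [h4]
      field_simp
      rfl
    change ∫ θ in Ioo (-Real.pi) Real.pi, Q (r, θ) = 0
    rw [← integral_Ioc_eq_integral_Ioo,
      ← intervalIntegral.integral_of_le (by linarith [Real.pi_pos]),
      intervalIntegral.integral_eq_sub_of_hasDerivAt (fun θ _ => hd θ)
        ((by fun_prop : Continuous fun θ => Q (r, θ)).intervalIntegrable _ _)]
    simp [e]
  rw [hpolar, integral_add hPi hQi, hPint, hQint, add_zero]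

end CauchyPompeiu

/-! ### The curve lies in the closure of its interior -/

section Vanishing

open scoped Manifold ContDiff

variable {α : Type*} [MeasurableSpace α] {μ : Measure α} {p φ : α → ℂ}

theorem integrableOn_ball_norm_inv (R : ℝ) :
    IntegrableOn (fun b : ℂ => ‖b‖⁻¹) (Metric.ball 0 R) := by
  refine integrableOn_ball_of_norm_le_rpow (C := 1) (α := 1) (by simp) (by simp)
    (.of_forall fun b => ?_) measurable_norm.inv.aestronglyMeasurable
  rw [Real.rpow_neg_one, one_mul, norm_inv, norm_norm]

/-- The kernel of the Cauchy–Pompeiu formula has an integrable majorant which is uniform for base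
points in a bounded set; this is what makes Fubini applicable. -/
theorem exists_integrable_bound_twiceDbar_div {f : ℂ → ℂ} (hf : ContDiff ℝ 1 f)
    (hc : HasCompactSupport f) (r : ℝ) :
    ∃ k : ℂ → ℝ, Integrable k ∧ ∀ w b : ℂ, ‖w‖ ≤ r → ‖twiceDbar f (w + b) / b‖ ≤ k b := by
  obtain ⟨R, hR⟩ := hc.twiceDbar.isCompact.isBounded.exists_norm_le
  obtain ⟨M, hM⟩ := (continuous_twiceDbar hf).bounded_above_of_compact_support hc.twiceDbar
  refine ⟨(Metric.ball 0 (R + r + 1)).indicator fun b => M * ‖b‖⁻¹,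
    IntegrableOn.integrable_indicator ((integrableOn_ball_norm_inv _).const_mul M)
      measurableSet_ball, ?_⟩
  intro w b hw
  have hM0 : 0 ≤ M := (norm_nonneg _).trans (hM 0)
  by_cases hb : b ∈ Metric.ball (0 : ℂ) (R + r + 1)
  · rw [indicator_of_mem hb, norm_div, div_eq_mul_inv]
    gcongr
    exact hM _
  · rw [indicator_of_notMem hb, norm_div]
    have : twiceDbar f (w + b) = 0 := by
      by_contra h
      refine hb ?_
      have h1 := hR _ (subset_tsupport _ h)
      have h2 := norm_sub_le (w + b) w
      rw [add_sub_cancel_left] at h2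
      rw [mem_ball_zero_iff]
      linarith
    simp [this]

/-- A test function supported where the Cauchy transform vanishes has integral zero: write it as the
integral of its `∂/∂z̄` derivative against the Cauchy kernel and interchange the integrals. -/
theorem integral_comp_mul_eq_zero_of_cauchyTransform [SFinite μ] (hp : Measurable p)
    (hb : IsBounded (range p)) (hφ : Integrable φ μ) {f : ℂ → ℂ} (hf : ContDiff ℝ 1 f)
    (hc : HasCompactSupport f) (h0 : ∀ᵐ a, a ∈ tsupport f → cauchyTransform μ p φ a = 0) :
    ∫ t, f (p t) * φ t ∂μ = 0 := by
  obtain ⟨r, hr⟩ := hb.exists_norm_le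
  obtain ⟨k, hk, hkb⟩ := exists_integrable_bound_twiceDbar_div hf hc r
  have hD := continuous_twiceDbar hf
  have hkt : ∀ t b, ‖twiceDbar f (p t + b) / b‖ ≤ k b := fun t b =>
    hkb _ _ (hr _ (mem_range_self t))
  have hmeas : ∀ w : ℂ, Measurable fun b => twiceDbar f (w + b) / b := fun w =>
    ((hD.comp (continuous_const_add w)).measurable).div measurable_id
  have hint : ∀ t, Integrable fun b => twiceDbar f (p t + b) / b := fun t =>
    hk.mono' (hmeas _).aestronglyMeasurable (.of_forall (hkt t))
  have hint' : ∀ t, Integrable fun a => twiceDbar f a / (a - p t) := fun t => by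
    have := (hint t).comp_sub_right (p t)
    simpa using this
  have hprod : Integrable (fun q : α × ℂ => φ q.1 * (twiceDbar f q.2 / (q.2 - p q.1)))
      (μ.prod volume) := by
    have hm : AEStronglyMeasurable
        (fun q : α × ℂ => φ q.1 * (twiceDbar f q.2 / (q.2 - p q.1))) (μ.prod volume) :=
      hφ.1.comp_fst.mul ((hD.measurable.comp measurable_snd).div
        (measurable_snd.sub (hp.comp measurable_fst))).aestronglyMeasurable
    rw [integrable_prod_iff hm]
    refine ⟨.of_forall fun t => (hint' t).const_mul (φ t), ?_⟩
    refine (hφ.norm.mul_const (∫ b, k b)).mono' hm.norm.integral_prod_right' (.of_forall fun t => ?_)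
    simp only [norm_mul, integral_const_mul, norm_norm]
    rw [Real.norm_of_nonneg (integral_nonneg fun _ => norm_nonneg _)]
    refine mul_le_mul_of_nonneg_left ?_ (norm_nonneg _)
    rw [← integral_add_right_eq_self _ (p t)]
    refine integral_mono (by simpa [add_comm] using (hint t).norm) hk fun b => ?_
    simpa [add_comm] using hkt t b
  have h1 : ∀ t, ∫ a, φ t * (twiceDbar f a / (a - p t)) = -(2 * Real.pi) * (f (p t) * φ t) := by
    intro t
    rw [integral_const_mul, ← integral_add_right_eq_self _ (p t)]
    have := integral_twiceDbar_div hf hc (p t)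
    simp only [add_comm _ (p t), add_sub_cancel_left]
    rw [this]
    ring
  have h2 : ∀ᵐ a : ℂ, ∫ t, φ t * (twiceDbar f a / (a - p t)) ∂μ = 0 := by
    filter_upwards [h0] with a ha
    by_cases hs : a ∈ tsupport f
    · have : ∀ t, φ t * (twiceDbar f a / (a - p t)) = -twiceDbar f a * ((p t - a)⁻¹ * φ t) := by
        intro t
        rw [← neg_sub (p t) a, div_neg, div_eq_mul_inv]
        ring
      simp only [this, integral_const_mul]
      rw [← cauchyTransform, ha hs, mul_zero]
    · have : twiceDbar f a = 0 := by
        by_contra h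
        exact hs (support_twiceDbar_subset h)
      simp [this]
  have h3 := integral_integral_swap (f := fun t a => φ t * (twiceDbar f a / (a - p t))) hprod
  rw [integral_congr_ae h2] at h3
  simp only [h1, integral_const_mul, integral_zero] at h3
  simpa [Real.pi_ne_zero] using h3

theorem exists_contDiff_eq_one_iff {K U : Set ℂ} (hK : IsCompact K) (hU : IsOpen U) (hKU : K ⊆ U) :
    ∃ f : ℂ → ℝ, ContDiff ℝ 1 f ∧ HasCompactSupport f ∧ tsupport f ⊆ U ∧
      (∀ z, f z ∈ Icc 0 1) ∧ ∀ z, z ∈ K ↔ f z = 1 := by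
  obtain ⟨L, hL, hKL, hLU⟩ := exists_compact_between hK hU hKU
  obtain ⟨f, hf, hr, h0, h1⟩ := exists_contMDiff_zero_iff_one_iff_of_isClosed 𝓘(ℝ, ℂ) (n := 1)
    isOpen_interior.isClosed_compl hK.isClosed (disjoint_left.2 fun z hz hz' => hz (hKL hz'))
  have hsupp : tsupport f ⊆ L := by
    refine closure_minimal (fun z hz => ?_) hL.isClosed
    by_contra h
    exact hz ((h0 z).1 fun h' => h (interior_subset h'))
  exact ⟨f, hf.contDiff, HasCompactSupport.of_support_subset_isCompact hL
    ((subset_tsupport f).trans hsupp), hsupp.trans hLU, fun z => hr (mem_range_self z), h1⟩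

/-- If the Cauchy transform of `φ μ` vanishes almost everywhere on an open set, then the image of
`φ μ` has no mass on compact subsets of that set. The powers of a smooth function which is equal
to `1` exactly on the compact set decrease to its indicator. -/
theorem setIntegral_preimage_eq_zero_of_cauchyTransform [SFinite μ] (hp : Measurable p)
    (hb : IsBounded (range p)) (hφ : Integrable φ μ) {K U : Set ℂ} (hK : IsCompact K)
    (hU : IsOpen U) (hKU : K ⊆ U) (h0 : ∀ᵐ a, a ∈ U → cauchyTransform μ p φ a = 0) :
    ∫ t in p ⁻¹' K, φ t ∂μ = 0 := by
  obtain ⟨f, hf, hc, hs, h01, h1⟩ := exists_contDiff_eq_one_iff hK hU hKU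
  have hz : ∀ n : ℕ, ∫ t, ((f (p t) ^ (n + 1) : ℝ) : ℂ) * φ t ∂μ = 0 := by
    intro n
    have hsub : tsupport (fun z => ((f z ^ (n + 1) : ℝ) : ℂ)) ⊆ tsupport f :=
      closure_mono fun z hz h => hz (by simp [h])
    refine integral_comp_mul_eq_zero_of_cauchyTransform
      (f := fun z => ((f z ^ (n + 1) : ℝ) : ℂ)) hp hb hφ
      (Complex.ofRealCLM.contDiff.comp (hf.pow _)) (hc.mono fun z hz h => hz (by simp [h])) ?_
    filter_upwards [h0] with a ha ha'
    exact ha (hs (hsub ha'))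
  have hlim : Tendsto (fun n : ℕ => ∫ t, ((f (p t) ^ (n + 1) : ℝ) : ℂ) * φ t ∂μ) atTop
      (𝓝 (∫ t, (p ⁻¹' K).indicator φ t ∂μ)) := by
    refine tendsto_integral_of_dominated_convergence (fun t => ‖φ t‖) (fun n => ?_) hφ.norm
      (fun n => .of_forall fun t => ?_) (.of_forall fun t => ?_)
    · exact (Complex.measurable_ofReal.comp
        ((hf.continuous.measurable.comp hp).pow_const _)).aestronglyMeasurable.mul hφ.1
    · have h := h01 (p t)
      rw [norm_mul, Complex.norm_real, norm_pow, Real.norm_of_nonneg h.1]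
      exact mul_le_of_le_one_left (norm_nonneg _) (pow_le_one₀ h.1 h.2)
    · by_cases ht : p t ∈ K
      · rw [indicator_of_mem (by exact ht)]
        simp [(h1 _).1 ht]
      · rw [indicator_of_notMem (by exact ht)]
        have hlt : f (p t) < 1 := lt_of_le_of_ne (h01 _).2 fun h => ht ((h1 _).2 h)
        have := ((tendsto_pow_atTop_nhds_zero_of_lt_one (h01 _).1 hlt).comp (tendsto_add_atTop_nat 1))
        have h3 := ((Complex.continuous_ofReal.tendsto 0).comp this).mul_const (φ t)
        simpa [Function.comp_def] using h3
  rw [← integral_indicator (hp hK.measurableSet)]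
  refine tendsto_nhds_unique hlim ?_
  simp only [hz]
  exact tendsto_const_nhds

end Vanishing

namespace RectifiableJordanCurve

variable {γ : RectifiableJordanCurve}

/-- The part of the Jordan curve theorem which is needed here: a point of the curve with no points
of index `1` nearby would have a neighbourhood in which `dz` has no mass on short arcs, and such
arcs would be closed. -/
theorem IsPositivelyOriented.trace_subset_closure_interior (hγ : γ.IsPositivelyOriented) :
    γ.trace ⊆ closure γ.interior := by
  -- By continuity it suffices to treat the parameters in `(0, 1)`, where the curve is injective.
  have hdense : γ.trace ⊆ closure (γ.toFun '' Ioo 0 1) := by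
    rw [trace, ← image_univ]
    refine (image_mono ?_).trans (image_closure_subset_closure_image γ.continuous_toFun)
    rw [closure_Ioo zero_ne_one]
    exact fun t _ => ⟨t.2.1, t.2.2⟩
  refine hdense.trans (closure_minimal ?_ isClosed_closure)
  rintro _ ⟨t, ht, rfl⟩
  by_contra hcl
  set U : Set ℂ := (closure γ.interior)ᶜ
  have hU : IsOpen U := isClosed_closure.isOpen_compl
  have h0 : ∀ᵐ a, a ∈ U → cauchyTransform γ.dz.variation γ.toFun γ.tangent a = 0 := by
    filter_upwards [measure_eq_zero_iff_ae_notMem.1 γ.volume_trace] with a ha haU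
    refine γ.cauchyTransform_tangent_eq_zero ⟨ha, (hγ a ha).resolve_right fun h => haU ?_⟩
    exact subset_closure ⟨ha, .inl h⟩
  obtain ⟨s, hst, hs⟩ : ∃ s < t, Icc s t ⊆ γ.toFun ⁻¹' U ∩ Ioi 0 := by
    have hn : γ.toFun ⁻¹' U ∩ Ioi 0 ∈ 𝓝 t :=
      inter_mem (γ.continuous_toFun.continuousAt.preimage_mem_nhds (hU.mem_nhds hcl))
        (Ioi_mem_nhds ht.1)
    obtain ⟨s, hs, h⟩ := exists_Ioc_subset_of_mem_nhds hn ⟨0, ht.1⟩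
    obtain ⟨s', h1, h2⟩ := exists_between hs
    exact ⟨s', h2, fun x hx => h ⟨h1.trans_le hx.1, hx.2⟩⟩
  -- The arc is not met again, not even at the double point `γ 0 = γ 1`, since `0 < s`.
  have hpre : γ.toFun ⁻¹' (γ.toFun '' Icc s t) = Icc s t := by
    refine subset_antisymm ?_ (subset_preimage_image _ _)
    rintro x ⟨y, hy, hxy⟩
    have hy1 : y < 1 := hy.2.trans_lt ht.2
    have hy0 : 0 < y := (hs hy).2
    rcases eq_or_ne x 1 with rfl | hx
    · rw [← γ.closed] at hxy
      exact absurd (γ.injOn hy1 (mem_Iio.2 zero_lt_one) hxy) hy0.ne'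
    · rwa [← γ.injOn hy1 (unitInterval.lt_one_iff_ne_one.2 hx) hxy]
  have h1 := setIntegral_preimage_eq_zero_of_cauchyTransform γ.continuous_toFun.measurable
    γ.isCompact_trace.isBounded γ.integrable_tangent
    (isCompact_Icc.image γ.continuous_toFun) hU (image_subset_iff.2 fun x hx => (hs hx).1) h0
  rw [hpre] at h1
  have h2 := γ.dz.setIntegral_density (measurableSet_Icc (a := s) (b := t))
  rw [γ.dz_Icc hst.le] at h2
  have h3 : γ.toFun t = γ.toFun s := sub_eq_zero.1 (h2.symm.trans h1)
  exact hst.ne' (γ.injOn ht.2 (hst.trans ht.2) h3)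

theorem IsPositivelyOriented.exterior_compl_subset (hγ : γ.IsPositivelyOriented) :
    γ.exteriorᶜ ⊆ closure γ.interior := by
  intro a ha
  by_cases h : a ∈ γ.trace
  · exact hγ.trace_subset_closure_interior h
  · exact subset_closure ⟨h, .inl ((hγ a h).resolve_left fun h0 => ha ⟨h, h0⟩)⟩

end RectifiableJordanCurve

/-! ### Weak integrals of the resolvent -/

section WeakIntegral

variable {α : Type*} [MeasurableSpace α] {μ : Measure α}
  {E : Type*} [NormedAddCommGroup E] [NormedSpace ℂ E] [CompleteSpace E]

/-- A weakly-* integrable family of functionals has uniformly bounded `L¹` norms, by the closed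
graph theorem for `E → L¹(μ)`: a sequence converging in `L¹` has a subsequence which converges
almost everywhere, so the limit is the pointwise one. -/
theorem exists_integral_norm_apply_le {u : α → StrongDual ℂ E}
    (hu : ∀ e, Integrable (fun t => u t e) μ) :
    ∃ C : ℝ, ∀ e, ∫ t, ‖u t e‖ ∂μ ≤ C * ‖e‖ := by
  let L : E →ₗ[ℂ] Lp ℂ 1 μ :=
    { toFun := fun e => (hu e).toL1 _
      map_add' := fun e e' => by
        rw [← Integrable.toL1_add]
        congr 1
        ext t
        simp
      map_smul' := fun c e => by
        rw [RingHom.id_apply, ← Integrable.toL1_smul]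
        congr 1
        ext t
        simp }
  have hLe : ∀ e, L e =ᵐ[μ] fun t => u t e := fun e => Integrable.coeFn_toL1 (hu e)
  have hL : Continuous L := by
    refine L.continuous_of_seq_closed_graph fun v e y hv hy => ?_
    obtain ⟨ns, hns, hae⟩ := (tendstoInMeasure_of_tendsto_Lp hy).exists_seq_tendsto_ae
    refine Lp.ext ?_
    filter_upwards [hae, hLe e, ae_all_iff.2 fun n => hLe (v n)] with t h1 h2 h3
    rw [h2]
    refine tendsto_nhds_unique h1 ?_
    simp only [Function.comp_apply, h3]
    exact ((u t).continuous.tendsto e).comp (hv.comp hns.tendsto_atTop)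
  let L' : E →L[ℂ] Lp ℂ 1 μ := ⟨L, hL⟩
  refine ⟨‖L'‖, fun e => ?_⟩
  have h := L'.le_opNorm e
  rw [L1.norm_eq_integral_norm] at h
  exact (integral_congr_ae ((hLe e).symm.fun_comp norm)).trans_le h

/-- The weak integral of a weakly-* integrable family of functionals against a bounded weight. -/
theorem exists_weak_integral {u : α → StrongDual ℂ E} (hu : ∀ e, Integrable (fun t => u t e) μ)
    {w : α → ℂ} (hw : AEStronglyMeasurable w μ) {B : ℝ} (hB : ∀ᵐ t ∂μ, ‖w t‖ ≤ B) :
    ∃ Λ : StrongDual ℂ E, ∀ e, Λ e = ∫ t, u t e * w t ∂μ := by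
  obtain ⟨C, hC⟩ := exists_integral_norm_apply_le hu
  have hi : ∀ e, Integrable (fun t => u t e * w t) μ := fun e => (hu e).mul_bdd hw hB
  let Λ : E →ₗ[ℂ] ℂ :=
    { toFun := fun e => ∫ t, u t e * w t ∂μ
      map_add' := fun e e' => by
        rw [← integral_add (hi e) (hi e')]
        simp [add_mul]
      map_smul' := fun c e => by
        rw [RingHom.id_apply, ← integral_smul]
        simp [mul_assoc] }
  refine ⟨Λ.mkContinuous (|B| * C) fun e => ?_, fun e => rfl⟩
  calc ‖∫ t, u t e * w t ∂μ‖ ≤ ∫ t, |B| * ‖u t e‖ ∂μ := by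
        refine norm_integral_le_of_norm_le ((hu e).norm.const_mul _) (hB.mono fun t ht => ?_)
        rw [norm_mul, mul_comm]
        gcongr
        exact ht.trans (le_abs_self B)
    _ ≤ |B| * C * ‖e‖ := by
        rw [integral_const_mul, mul_assoc]
        exact mul_le_mul_of_nonneg_left (hC e) (abs_nonneg B)

/-- The truncated Riesz projection. If `u` is weakly-* integrable along `γ` and `u z` solves
`(z - A*) u z = ξ` almost everywhere on `γ`, then `G = ∫ u z dz` has an analytic local resolvent
outside `γ`, namely `g a = ∫ u z / (z - a) dz`, which solves `(A* - a) g a = G`. -/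
theorem RectifiableJordanCurve.exists_truncated_projection {γ : RectifiableJordanCurve}
    (A : E →L[ℂ] E) (u : ℂ → StrongDual ℂ E)
    (ξ : StrongDual ℂ E) (hu : ∀ e, γ.Integrable fun z => u z e)
    (hres : ∀ᵐ t ∂γ.dz.variation, ∀ e, u (γ.toFun t) (γ.toFun t • e - A e) = ξ e) :
    ∃ (G : StrongDual ℂ E) (g : ℂ → StrongDual ℂ E),
      (∀ e, G e = γ.lineIntegral fun z => u z e) ∧
      (∀ a ∈ γ.exterior, ∀ e, g a (A e - a • e) = G e) ∧
      (∀ a ∈ γ.exterior, ∀ e, DifferentiableAt ℂ (fun b => g b e) a) ∧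
      ∀ e, Tendsto (fun a => a * g a e) (cobounded ℂ) (𝓝 (-G e)) := by
  have hu' : ∀ e, MeasureTheory.Integrable (fun t => u (γ.toFun t) e) γ.dz.variation := hu
  have hd := γ.integrable_tangent
  have hb : ∀ᵐ t ∂γ.dz.variation, ‖γ.tangent t‖ ≤ 2 := γ.dz.norm_density_le
  have hφ : ∀ e, MeasureTheory.Integrable (fun t => u (γ.toFun t) e * γ.tangent t)
      γ.dz.variation := fun e => (hu' e).mul_bdd hd.1 hb
  obtain ⟨G, hG⟩ := exists_weak_integral hu' hd.1 hb
  have hex : ∀ a, ∃ Λ : StrongDual ℂ E, a ∉ γ.trace → ∀ e, Λ e =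
      cauchyTransform γ.dz.variation γ.toFun (fun t => u (γ.toFun t) e * γ.tangent t) a := by
    intro a
    by_cases ha : a ∈ γ.trace
    · exact ⟨0, fun h => absurd ha h⟩
    obtain ⟨δ, hδ, hdist⟩ := Metric.mem_nhds_iff.1
      (γ.isCompact_trace.isClosed.isOpen_compl.mem_nhds ha)
    obtain ⟨Λ, hΛ⟩ := exists_weak_integral hu' (w := fun t => (γ.toFun t - a)⁻¹ * γ.tangent t)
      (B := δ⁻¹ * 2)
      ((γ.continuous_toFun.measurable.sub_const a).inv.aestronglyMeasurable.mul hd.1) (by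
        filter_upwards [hb] with t ht
        have : δ ≤ ‖γ.toFun t - a‖ := by
          by_contra! h
          exact hdist (by simpa [dist_eq_norm] using h) (mem_range_self t)
        rw [norm_mul, norm_inv]
        gcongr)
    refine ⟨Λ, fun _ e => (hΛ e).trans (integral_congr_ae (.of_forall fun t => ?_))⟩
    simp only
    ring
  choose g hg using hex
  refine ⟨G, g, fun e => by rw [hG, γ.lineIntegral_eq (hu e)], fun a ha e => ?_, fun a ha e => ?_,
    fun e => ?_⟩
  · have hker := integrable_cauchyKernel_mul (a := a) γ.continuous_toFun.measurable hd
      (by rw [γ.closure_range_toFun]; exact ha.1)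
    rw [hg a ha.1, hG]
    calc ∫ t, (γ.toFun t - a)⁻¹ * (u (γ.toFun t) (A e - a • e) * γ.tangent t) ∂γ.dz.variation
        = ∫ t, u (γ.toFun t) e * γ.tangent t - ξ e * ((γ.toFun t - a)⁻¹ * γ.tangent t)
            ∂γ.dz.variation := by
          refine integral_congr_ae (hres.mono fun t ht => ?_)
          have hne : γ.toFun t - a ≠ 0 := sub_ne_zero.2 fun h => ha.1 ⟨t, h⟩
          -- `(A - a) e` is `(z - a) e` minus `(z - A) e`; the second part yields the constant `ξ e`.
          have hsplit : A e - a • e = (γ.toFun t - a) • e - (γ.toFun t • e - A e) := by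
            rw [sub_smul]; abel
          simp only
          rw [hsplit, map_sub, ht, map_smul, smul_eq_mul]
          field_simp
      _ = _ := by
          rw [integral_sub (hφ e) (hker.const_mul _), integral_const_mul, ← cauchyTransform,
            γ.cauchyTransform_tangent_eq_zero ha, mul_zero, sub_zero]
  · refine (γ.differentiableAt_cauchyTransform (hφ e) ha.1).congr_of_eventuallyEq ?_
    filter_upwards [γ.isCompact_trace.isClosed.isOpen_compl.mem_nhds ha.1] with b hb
    exact hg b hb e
  · rw [hG]
    refine (tendsto_mul_cauchyTransform γ.continuous_toFun.measurable γ.isCompact_trace.isBounded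
      (hφ e)).congr' ?_
    filter_upwards [isBounded_def.1 γ.isCompact_trace.isBounded] with a ha
    rw [hg a ha]

end WeakIntegral

/-! ### The hyperinvariant subspace -/

section Hyperinvariant

/-- A function given by local analytic formulas on two open sets covering the plane, which vanishes
at infinity, is zero; hence so is its leading coefficient at infinity. -/
theorem eq_zero_of_tendsto_mul_of_eqOn {U V : Set ℂ} (hU : IsOpen U) (hV : IsOpen V)
    (hUV : U ∪ V = univ) (hUb : ∀ᶠ a in cobounded ℂ, a ∈ U) {f g : ℂ → ℂ}
    (hf : ∀ a ∈ U, DifferentiableAt ℂ f a) (hg : ∀ a ∈ V, DifferentiableAt ℂ g a)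
    (hfg : EqOn f g (U ∩ V)) {c : ℂ} (hc : Tendsto (fun a => a * f a) (cobounded ℂ) (𝓝 c)) :
    c = 0 := by
  classical
  let F : ℂ → ℂ := U.piecewise f g
  have hFU : EqOn F f U := fun a ha => piecewise_eq_of_mem _ _ _ ha
  have hFV : EqOn F g V := fun a ha => by
    by_cases h : a ∈ U
    · rw [hFU h, hfg ⟨h, ha⟩]
    · exact piecewise_eq_of_notMem _ _ _ h
  have hF : Differentiable ℂ F := by
    intro a
    rcases (hUV ▸ mem_univ a : a ∈ U ∪ V) with ha | ha
    · exact (hf a ha).congr_of_eventuallyEq (hFU.eventuallyEq_of_mem (hU.mem_nhds ha))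
    · exact (hg a ha).congr_of_eventuallyEq (hFV.eventuallyEq_of_mem (hV.mem_nhds ha))
  have hFc : Tendsto (fun a => a * F a) (cobounded ℂ) (𝓝 c) :=
    hc.congr' (hUb.mono fun a ha => by simp only [hFU ha])
  have hF0 : Tendsto F (cobounded ℂ) (𝓝 0) := by
    have h := hFc.mul (tendsto_inv₀_cobounded (α := ℂ))
    rw [mul_zero] at h
    refine h.congr' ?_
    filter_upwards [(tendsto_norm_cobounded_atTop (E := ℂ)).eventually_gt_atTop 0] with a ha
    have : a ≠ 0 := norm_pos_iff.1 ha
    field_simp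
  have hz : ∀ a, F a = 0 := fun a =>
    hF.apply_eq_of_tendsto_cocompact a (by rwa [← Metric.cobounded_eq_cocompact])
  simp only [hz, mul_zero] at hFc
  exact tendsto_nhds_unique hFc tendsto_const_nhds

variable {X : Type*} [NormedAddCommGroup X] [NormedSpace ℂ X] {T : X →L[ℂ] X}

theorem smul_sub_resolvent_apply {z : ℂ} (hz : z ∉ spectrum ℂ T) (x : X) :
    z • resolvent T z x - T (resolvent T z x) = x := by
  have h := Ring.mul_inverse_cancel _ (spectrum.notMem_iff.1 hz)
  have h2 := congrArg (fun S : X →L[ℂ] X => S x) h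
  simpa [resolvent, Algebra.algebraMap_eq_smul_one] using h2

/-- Taking adjoints is antimultiplicative, so it maps the inverse of `z - T` to an inverse of
`z - T*`. -/
theorem notMem_spectrum_dualOperator {z : ℂ} (hz : z ∉ spectrum ℂ T) :
    z ∉ spectrum ℂ (dualOperator T) := by
  obtain ⟨R, hR⟩ := spectrum.notMem_iff.1 hz
  rw [spectrum.notMem_iff]
  have hmul : ∀ P Q : X →L[ℂ] X, dualOperator P * dualOperator Q = dualOperator (Q * P) :=
    fun _ _ => rfl
  have hone : dualOperator (1 : X →L[ℂ] X) = 1 := rfl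
  refine ⟨⟨dualOperator R, dualOperator (R⁻¹ : (X →L[ℂ] X)ˣ), ?_, ?_⟩, ?_⟩
  · rw [hmul, Units.inv_mul, hone]
  · rw [hmul, Units.mul_inv, hone]
  · ext y h
    simp [hR, dualOperator, Algebra.algebraMap_eq_smul_one]

theorem RectifiableJordanCurve.ae_notMem_of_arcLength_eq_zero {γ : RectifiableJordanCurve}
    {s : Set ℂ} (h : γ.arcLength (γ.trace ∩ s) = 0) :
    ∀ᵐ t ∂γ.dz.variation, γ.toFun t ∉ s := by
  have h1 : ∀ᵐ z ∂γ.arcLength, z ∉ γ.trace ∩ s := measure_eq_zero_iff_ae_notMem.1 h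
  filter_upwards [ae_of_ae_map γ.continuous_toFun.measurable.aemeasurable h1] with t ht hs
  exact ht ⟨mem_range_self t, hs⟩

/-- If a nonzero functional `y` annihilates the orbit of a nonzero vector under the commutant of
`T`, then the vectors whose orbit is annihilated by `y` form a hyperinvariant subspace. -/
theorem exists_hyperinvariant_of_annihilated_orbit {x : X} (hx : x ≠ 0) {y : StrongDual ℂ X}
    (hy : y ≠ 0) (h : ∀ S : X →L[ℂ] X, Commute S T → y (S x) = 0) :
    ∃ M : Submodule ℂ X, IsClosed (M : Set X) ∧ M ≠ ⊥ ∧ M ≠ ⊤ ∧ IsHyperinvariant T M := by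
  let M : Submodule ℂ X :=
    ⨅ S : {S : X →L[ℂ] X // Commute S T}, LinearMap.ker (y.comp S.1).toLinearMap
  have hM : ∀ v, v ∈ M ↔ ∀ S : X →L[ℂ] X, Commute S T → y (S v) = 0 := by
    intro v
    simp [M, Submodule.mem_iInf]
  refine ⟨M, ?_, fun h0 => ?_, fun h1 => hy ?_, fun S hS v hv => ?_⟩
  · have : (M : Set X) = ⋂ S : {S : X →L[ℂ] X // Commute S T}, (y.comp S.1) ⁻¹' {0} := by
      ext v
      simp [hM]
    rw [this]
    exact isClosed_iInter fun S => isClosed_singleton.preimage (y.comp S.1).continuous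
  · exact hx ((Submodule.mem_bot ℂ).1 (h0 ▸ (hM x).2 h))
  · ext v
    exact (hM v).1 (h1 ▸ Submodule.mem_top) 1 (Commute.one_left T)
  · exact (hM _).2 fun S' hS' => (hM v).1 hv (S' * S) (hS'.mul_left hS)

end Hyperinvariant

theorem mainTheorem3 {X : Type*} [NormedAddCommGroup X] [NormedSpace ℂ X] [CompleteSpace X]
    (hX : IsReflexiveSpace X) (T : X →L[ℂ] X) (hT : HasSVEP T)
    (γ₁ γ₂ : RectifiableJordanCurve)
    (hpos₁ : γ₁.IsPositivelyOriented) (hpos₂ : γ₂.IsPositivelyOriented)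
    (hne₁ : (γ₁.trace ∩ spectrum ℂ T).Nonempty) (hne₂ : (γ₂.trace ∩ spectrum ℂ T).Nonempty)
    (hnull₁ : γ₁.arcLength (γ₁.trace ∩ spectrum ℂ T) = 0)
    (hnull₂ : γ₂.arcLength (γ₂.trace ∩ spectrum ℂ T) = 0)
    (hint₁ : (γ₁.interior ∩ spectrum ℂ T).Nonempty)
    (hext₁ : (γ₁.exterior ∩ spectrum ℂ T).Nonempty)
    (hint₂ : (γ₂.interior ∩ spectrum ℂ T).Nonempty)
    (hext₂ : (γ₂.exterior ∩ spectrum ℂ T).Nonempty)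
    (hdisj : closure γ₁.interior ∩ closure γ₂.interior = ∅)
    (ha : ∃ x : X, (∀ y : StrongDual ℂ X, γ₁.Integrable fun z => y (resolvent T z x)) ∧
      ∃ y₀ : StrongDual ℂ X, γ₁.lineIntegral (fun z => y₀ (resolvent T z x)) ≠ 0)
    (hb : ∃ x' : StrongDual ℂ X,
      (∀ h : X, γ₂.Integrable fun z => resolvent (dualOperator T) z x' h) ∧
      ∃ h₀ : X, γ₂.lineIntegral (fun z => resolvent (dualOperator T) z x' h₀) ≠ 0) :
    ∃ M : Submodule ℂ X, IsClosed (M : Set X) ∧ M ≠ ⊥ ∧ M ≠ ⊤ ∧ IsHyperinvariant T M := by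
  obtain ⟨x, hxi, y₀, hy₀⟩ := ha
  obtain ⟨x', hxi', h₀, hh₀⟩ := hb
  obtain ⟨G₁, g₁, hG₁, hres₁, hdiff₁, hlim₁⟩ :=
    γ₁.exists_truncated_projection (dualOperator T)
      (fun z => NormedSpace.inclusionInDoubleDual ℂ X (resolvent T z x))
      (NormedSpace.inclusionInDoubleDual ℂ X x) hxi (by
        filter_upwards [γ₁.ae_notMem_of_arcLength_eq_zero hnull₁] with t ht y
        have := congrArg y (smul_sub_resolvent_apply ht x)
        rw [map_sub, map_smul] at this
        exact this)
  obtain ⟨G₂, g₂, hG₂, hres₂, hdiff₂, -⟩ :=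
    γ₂.exists_truncated_projection T (fun z => resolvent (dualOperator T) z x') x' hxi' (by
        filter_upwards [γ₂.ae_notMem_of_arcLength_eq_zero hnull₂] with t ht h
        have := congrArg (fun y : StrongDual ℂ X => y h)
          (smul_sub_resolvent_apply (notMem_spectrum_dualOperator ht) x')
        rw [map_sub, map_smul]
        exact this)
  -- Reflexivity: the weak integral of the resolvent is an element of `X`.
  obtain ⟨x₁, rfl⟩ := hX G₁
  have hcover : γ₁.exterior ∪ γ₂.exterior = univ := by
    rw [eq_univ_iff_forall]
    intro a
    by_contra h
    rw [mem_union, not_or] at h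
    exact (hdisj ▸ (⟨hpos₁.exterior_compl_subset h.1, hpos₂.exterior_compl_subset h.2⟩ :
      a ∈ closure γ₁.interior ∩ closure γ₂.interior) : a ∈ (∅ : Set ℂ))
  refine exists_hyperinvariant_of_annihilated_orbit (x := x₁) (y := G₂) ?_ ?_ fun S hS => ?_
  · rintro rfl
    exact hy₀ ((hG₁ y₀).symm.trans (by simp))
  · rintro rfl
    exact hh₀ ((hG₂ h₀).symm.trans (by simp))
  · have h := eq_zero_of_tendsto_mul_of_eqOn hpos₁.isOpen_exterior hpos₂.isOpen_exterior hcover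
      hpos₁.eventually_mem_exterior (f := fun a => g₁ a (dualOperator S G₂))
      (g := fun a => g₂ a (S x₁)) (fun a ha => hdiff₁ a ha _) (fun a ha => hdiff₂ a ha _) ?_
      (hlim₁ _)
    · exact neg_eq_zero.1 h
    · rintro a ⟨ha₁, ha₂⟩
      -- `S* G₂ = (T* - a) S* (g₂ a)`, so both local resolvents give `(g₂ a) (S x₁)`.
      have hk : dualOperator S G₂ =
          dualOperator T (dualOperator S (g₂ a)) - a • dualOperator S (g₂ a) := by
        ext h
        have h1 := hres₂ a ha₂ (S h)
        have h2 : T (S h) = S (T h) := congrArg (fun R : X →L[ℂ] X => R h) hS.eq.symm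
        rw [h2, map_sub, map_smul] at h1
        exact h1.symm
      have h3 := hres₁ a ha₁ (dualOperator S (g₂ a))
      rw [← hk] at h3
      exact h3
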